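/- There is an absolute constant $C>0$ such that the following holds for all $n\in\mathbb N$, all real $n\times n$ matrices $A$ and all $\epsilon>0$. Put $$A'=\begin{pmatrix}0&A\\A^T&0\end{pmatrix}\in\mathbb R^{2n\times 2n},$$ and let $\|\cdot\|$ denote the operator norm with respect to the Euclidean norm. Call a real positive semidefinite $2n\times 2n$ matrix $X$ with $\mathrm{tr}(X)=1$ feasible if $X_{ii}=\frac1{2n}$ for all $i$, and let $\rho^\sharp$ be a real positive semidefinite $2n\times2n$ matrix with $\mathrm{tr}(\rho^\sharp)=1$ that is (i) approximately feasible with accuracy $\epsilon^4$, i.e. $\sum_{i=1}^{2n}\left|\rho^\sharp_{ii}-\frac1{2n}\right|\le\epsilon^4$, and (ii) optimal with accuracy $\epsilon^4$, i.e. $\mathrm{tr}\big(\tfrac1{\|A'\|}A'\rho^\sharp\big)\ge\mathrm{tr}\big(\tfrac1{\|A'\|}A'X\big)-\epsilon^4$ for every feasible $X$ (the condition is void if $A=0$). Let $v_1,\dots,v_{2n}$ be the columns of the positive semidefinite square root $\sqrt{\rho^\sharp}$, let $g\in\mathbb R^{2n}$ be a random vector with i.i.d. standard normal entries, and set $x_i=\mathrm{sign}(\langle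 v_i,g\rangle)\in\{\pm1\}$ (with $\mathrm{sign}(t)=1$ for $t\ge0$ and $-1$ for $t<0$), $y=(x_1,\dots,x_n)$ and $z=(x_{n+1},\dots,x_{2n})$. Then $$\Big(\frac4\pi-1\Big)\,n\,\mathrm{tr}(\rho^\sharp A')-C\,\epsilon\, n\,\|A\|\;\le\;\sum_{i,j=1}^nA_{ij}\,\mathbb E(y_iz_j)\;\le\; n\,\mathrm{tr}(\rho^\sharp A')+C\,\epsilon\, n\,\|A\|.$$ -/

import Mathlib

open MeasureTheory ProbabilityTheory
open scoped MatrixOrder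

namespace MaxQP

noncomputable section

/-- The operator norm of a real square matrix with respect to the Euclidean norm. -/
def opNorm {ι : Type*} [Fintype ι] [DecidableEq ι] (A : Matrix ι ι ℝ) : ℝ :=
  ‖Matrix.toEuclideanCLM (𝕜 := ℝ) A‖

/-- The objective `tr ((1 / ‖A‖) A X)` of the renormalized MaxQP SDP with input matrix `A`. -/
def value {ι : Type*} [Fintype ι] [DecidableEq ι] (A X : Matrix ι ι ℝ) : ℝ :=
  (((1 / opNorm A) • A) * X).trace

/-- Exactly feasible points of the renormalized MaxQP SDP: positive semidefinite matrices of trace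
one all of whose diagonal entries equal one over the dimension. -/
structure IsFeasible {ι : Type*} [Fintype ι] (X : Matrix ι ι ℝ) : Prop where
  posSemidef : X.PosSemidef
  trace_eq_one : X.trace = 1
  diag_eq : ∀ i, X i i = 1 / (Fintype.card ι : ℝ)

/-- Approximately feasible points with accuracy `δ`: the diagonal constraints are
relaxed to a single bound on the sum of the deviations. -/
structure IsApproxFeasible {ι : Type*} [Fintype ι] (δ : ℝ) (X : Matrix ι ι ℝ) : Prop where
  posSemidef : X.PosSemidef
  trace_eq_one : X.trace = 1
  sum_diag_le : ∑ i, |X i i - 1 / (Fintype.card ι : ℝ)| ≤ δ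

/-- `ρ` is optimal with accuracy `δ`: its value is at least the optimal value of the renormalized
MaxQP SDP with input matrix `A`, up to the additive error `δ`. -/
def IsApproxOptimal {ι : Type*} [Fintype ι] [DecidableEq ι] (A : Matrix ι ι ℝ) (δ : ℝ)
    (ρ : Matrix ι ι ℝ) : Prop :=
  ∀ X : Matrix ι ι ℝ, IsFeasible X → value A X ≤ value A ρ + δ

/-- The symmetric block matrix with blocks `0, A, Aᵀ, 0`. -/
def lift {n : ℕ} (A : Matrix (Fin n) (Fin n) ℝ) : Matrix (Fin n ⊕ Fin n) (Fin n ⊕ Fin n) ℝ :=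
  Matrix.fromBlocks 0 A A.transpose 0

/-- The sign with values in `{1, -1}`. -/
def sgn (t : ℝ) : ℝ := if 0 ≤ t then 1 else -1

/-- The rounded vector `x i = sgn ⟨v i, g⟩`, where `v i` is the `i`-th column of the positive
semidefinite square root of `ρ`. -/
def roundVec {ι : Type*} [Fintype ι] [DecidableEq ι] (ρ : Matrix ι ι ℝ) (g : ι → ℝ) (i : ι) : ℝ :=
  sgn ((CFC.sqrt ρ).col i ⬝ᵥ g)

end

end MaxQP

/-! Write `N = 2n`, let `U` have the normalized columns of `√ρ`, and let `x` be the rounded sign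
vector. The matrix `E[x xᵀ]` is positive semidefinite with unit diagonal, so near-optimality of `ρ`
gives the upper bound at once.

For the lower bound, regress `x` on the Gaussian vector `Uᵀg`. Since `E[sgn(⟨a,g⟩)⟨b,g⟩] =
√(2/π)⟨a,b⟩` for unit `a`, the residual `x - √(2/π) Uᵀg` has second moment `E[x xᵀ] - (2/π) UᵀU`,
which is positive semidefinite with diagonal at most `1 - 2/π`. Conjugation by `diag(1,-1)` negates
`tr(A' ·)`, so optimality also bounds this trace from below, by about `-(1 - 2/π) N tr(A'ρ)`. As
`UᵀU ≈ Nρ`, the total is `(2/π - (1 - 2/π)) N tr(A'ρ) = (4/π - 1) N tr(A'ρ)`. The key lemmas are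
`IsApproxOptimal.neg_le_trace`, `secondMoment_residual` and `abs_trace_unitCols_sub_le`. -/

namespace MaxQP

open Matrix

/-! ### Operator norm bounds for traces against Gram matrices. -/

section LinearAlgebra

variable {ι κ : Type*} [Fintype ι] [DecidableEq ι] [Fintype κ]

lemma opNorm_nonneg (A : Matrix ι ι ℝ) : 0 ≤ opNorm A := norm_nonneg _

lemma abs_dotProduct_mulVec_le (A : Matrix ι ι ℝ) (u v : ι → ℝ) :
    |u ⬝ᵥ A *ᵥ v| ≤ opNorm A * (√(∑ i, u i ^ 2) * √(∑ i, v i ^ 2)) := by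
  have h := Matrix.inner_toEuclideanCLM A (WithLp.toLp 2 u) (WithLp.toLp 2 v)
  have h1 := abs_real_inner_le_norm (WithLp.toLp 2 u)
    (Matrix.toEuclideanCLM (𝕜 := ℝ) A (WithLp.toLp 2 v))
  have h2 := (Matrix.toEuclideanCLM (𝕜 := ℝ) A).le_opNorm (WithLp.toLp 2 v)
  rw [h] at h1
  have hu : ‖(WithLp.toLp 2 u : EuclideanSpace ℝ ι)‖ = √(∑ i, u i ^ 2) := by
    simp [EuclideanSpace.norm_eq]
  have hv : ‖(WithLp.toLp 2 v : EuclideanSpace ℝ ι)‖ = √(∑ i, v i ^ 2) := by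
    simp [EuclideanSpace.norm_eq]
  rw [hu] at h1
  rw [hv] at h2
  refine h1.trans ((mul_le_mul_of_nonneg_left h2 (Real.sqrt_nonneg _)).trans_eq ?_)
  unfold opNorm
  ring

lemma opNorm_le_of_abs_dotProduct_le {A : Matrix ι ι ℝ} {K : ℝ} (hK : 0 ≤ K)
    (h : ∀ u v : ι → ℝ, |u ⬝ᵥ A *ᵥ v| ≤ K * (√(∑ i, u i ^ 2) * √(∑ i, v i ^ 2))) :
    opNorm A ≤ K := by
  refine ContinuousLinearMap.opNorm_le_bound _ hK fun x => ?_
  have h1 := h (Matrix.toEuclideanCLM (𝕜 := ℝ) A x).ofLp x.ofLp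
  have h2 := Matrix.inner_toEuclideanCLM A (Matrix.toEuclideanCLM (𝕜 := ℝ) A x) x
  rw [real_inner_self_eq_norm_sq] at h2
  rw [← h2] at h1
  have hx : ∀ x : EuclideanSpace ℝ ι, √(∑ i, x i ^ 2) = ‖x‖ := fun x => by
    simp [EuclideanSpace.norm_eq]
  rw [hx, hx, abs_of_nonneg (sq_nonneg _)] at h1
  rcases (norm_nonneg (Matrix.toEuclideanCLM (𝕜 := ℝ) A x)).eq_or_lt with h0 | h0
  · rw [← h0]; positivity
  · refine le_of_mul_le_mul_left ?_ h0
    linarith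

lemma abs_trace_mul_gram_le (A : Matrix ι ι ℝ) (U V : Matrix κ ι ℝ) :
    |(A * (Uᵀ * V)).trace| ≤
      opNorm A * (√(∑ k, ∑ i, U k i ^ 2) * √(∑ k, ∑ i, V k i ^ 2)) := by
  have h : (A * (Uᵀ * V)).trace = ∑ k, V k ⬝ᵥ A *ᵥ U k := by
    rw [← Matrix.mul_assoc, Matrix.trace_mul_comm, Matrix.trace]
    refine Finset.sum_congr rfl fun k _ => ?_
    simp [Matrix.mul_apply, dotProduct, Matrix.mulVec]
  rw [h]
  calc |∑ k, V k ⬝ᵥ A *ᵥ U k| ≤ ∑ k, |V k ⬝ᵥ A *ᵥ U k| := Finset.abs_sum_le_sum_abs _ _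
    _ ≤ ∑ k, opNorm A * (√(∑ i, U k i ^ 2) * √(∑ i, V k i ^ 2)) := by
        refine Finset.sum_le_sum fun k _ => (abs_dotProduct_mulVec_le A _ _).trans_eq ?_
        ring
    _ = opNorm A * ∑ k, √(∑ i, U k i ^ 2) * √(∑ i, V k i ^ 2) := by rw [Finset.mul_sum]
    _ ≤ _ := by
        refine mul_le_mul_of_nonneg_left ?_ (opNorm_nonneg A)
        exact Real.sum_sqrt_mul_sqrt_le _ (fun k => Finset.sum_nonneg fun i _ => sq_nonneg _)
          (fun k => Finset.sum_nonneg fun i _ => sq_nonneg _)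

/-- Gram matrices of nearby families have nearby traces against `A`. -/
lemma abs_trace_mul_gram_sub_le (A : Matrix ι ι ℝ) (U V : Matrix κ ι ℝ) {s t : ℝ}
    (hU : ∑ k, ∑ i, U k i ^ 2 ≤ s) (hV : ∑ k, ∑ i, V k i ^ 2 ≤ s)
    (hUV : ∑ k, ∑ i, (U - V) k i ^ 2 ≤ t) :
    |(A * (Uᵀ * U)).trace - (A * (Vᵀ * V)).trace| ≤ 2 * (opNorm A * (√s * √t)) := by
  -- Telescoping: each term has a single factor `U - V`, and Cauchy–Schwarz applies to it.
  have h : (A * (Uᵀ * U)).trace - (A * (Vᵀ * V)).trace =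
      (A * (Uᵀ * (U - V))).trace + (A * ((U - V)ᵀ * V)).trace := by
    rw [← Matrix.trace_sub, ← Matrix.trace_add]
    congr 1
    rw [Matrix.transpose_sub]
    rw [Matrix.sub_mul, Matrix.mul_sub, Matrix.mul_sub, Matrix.mul_sub]
    abel
  rw [h]
  have h1 := abs_trace_mul_gram_le A U (U - V)
  have h2 := abs_trace_mul_gram_le A (U - V) V
  have hA := opNorm_nonneg A
  have h3 : opNorm A * (√(∑ k, ∑ i, U k i ^ 2) * √(∑ k, ∑ i, (U - V) k i ^ 2)) ≤
      opNorm A * (√s * √t) := by gcongr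
  have h4 : opNorm A * (√(∑ k, ∑ i, (U - V) k i ^ 2) * √(∑ k, ∑ i, V k i ^ 2)) ≤
      opNorm A * (√t * √s) := by gcongr
  rw [mul_comm √t] at h4
  have := abs_add_le (A * (Uᵀ * (U - V))).trace (A * ((U - V)ᵀ * V)).trace
  linarith

lemma trace_mul_vecMulVec_self {ι : Type*} [Fintype ι] (A : Matrix ι ι ℝ) (u : ι → ℝ) :
    (A * vecMulVec u u).trace = u ⬝ᵥ A *ᵥ u := by
  rw [Matrix.mul_vecMulVec, Matrix.trace_vecMulVec, dotProduct_comm]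

lemma abs_dotProduct_mulVec_sub_le (A : Matrix ι ι ℝ) (u v : ι → ℝ) {s t : ℝ}
    (hu : ∑ i, u i ^ 2 ≤ s) (hv : ∑ i, v i ^ 2 ≤ s) (huv : ∑ i, (u i - v i) ^ 2 ≤ t) :
    |u ⬝ᵥ A *ᵥ u - v ⬝ᵥ A *ᵥ v| ≤ 2 * (opNorm A * (√s * √t)) := by
  have h := abs_trace_mul_gram_sub_le A (Matrix.replicateRow Unit u) (Matrix.replicateRow Unit v)
    (s := s) (t := t) (by simpa using hu) (by simpa using hv) (by simpa using huv)
  have key : ∀ w : ι → ℝ, (replicateRow Unit w)ᵀ * replicateRow Unit w = vecMulVec w w := by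
    intro w; ext i j; simp [Matrix.mul_apply, vecMulVec_apply]
  rwa [key, key, trace_mul_vecMulVec_self, trace_mul_vecMulVec_self] at h

/-! ### Normalizing the columns of the square root. -/

section Sqrt

variable {ρ : Matrix ι ι ℝ}

lemma transpose_sqrt : (CFC.sqrt ρ)ᵀ = CFC.sqrt ρ := by
  have h := (Matrix.nonneg_iff_posSemidef.mp (CFC.sqrt_nonneg ρ)).isHermitian
  simpa [Matrix.IsHermitian] using h

lemma transpose_sqrt_mul_sqrt (hρ : ρ.PosSemidef) : (CFC.sqrt ρ)ᵀ * CFC.sqrt ρ = ρ := by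
  rw [transpose_sqrt, CFC.sqrt_mul_sqrt_self ρ (Matrix.nonneg_iff_posSemidef.mpr hρ)]

lemma sum_sqrt_sq (hρ : ρ.PosSemidef) (i : ι) : ∑ k, CFC.sqrt ρ k i ^ 2 = ρ i i := by
  conv_rhs => rw [← transpose_sqrt_mul_sqrt hρ]
  simp [Matrix.mul_apply, sq]

lemma abs_trace_mul_le (hρ : ρ.PosSemidef) (A : Matrix ι ι ℝ) :
    |(A * ρ).trace| ≤ opNorm A * ρ.trace := by
  have h := abs_trace_mul_gram_le A (CFC.sqrt ρ) (CFC.sqrt ρ)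
  rw [transpose_sqrt_mul_sqrt hρ] at h
  have h1 : ∑ k, ∑ i, CFC.sqrt ρ k i ^ 2 = ρ.trace := by
    rw [Finset.sum_comm]
    exact Finset.sum_congr rfl fun i _ => sum_sqrt_sq hρ i
  rwa [h1, Real.mul_self_sqrt hρ.trace_nonneg] at h

/-- The matrix whose columns are the normalized columns of the square root of `ρ`. -/
noncomputable def unitCols (ρ : Matrix ι ι ℝ) : Matrix ι ι ℝ :=
  Matrix.of fun k i => (√(ρ i i))⁻¹ * CFC.sqrt ρ k i

/-- The convention `0⁻¹ = 0` makes the column zero where `ρ i i = 0`. -/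
lemma sum_unitCols_sq (hρ : ρ.PosSemidef) (i : ι) :
    ∑ k, unitCols ρ k i ^ 2 = if ρ i i = 0 then 0 else 1 := by
  simp only [unitCols, Matrix.of_apply, mul_pow, ← Finset.mul_sum, sum_sqrt_sq hρ, inv_pow,
    Real.sq_sqrt hρ.diag_nonneg]
  split_ifs with h
  · simp [h]
  · exact inv_mul_cancel₀ h

/-- Normalizing the columns of the square root changes the trace against `A` by an amount
controlled by the deviation of the diagonal of `ρ` from the constant `1 / card ι`. -/
lemma abs_trace_unitCols_sub_le (hρ : ρ.PosSemidef) (ht : ρ.trace = 1) {δ : ℝ}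
    (hδ : ∑ i, |ρ i i - 1 / (Fintype.card ι : ℝ)| ≤ δ) (A : Matrix ι ι ℝ) :
    |(A * ((unitCols ρ)ᵀ * unitCols ρ)).trace - Fintype.card ι * (A * ρ).trace| ≤
      2 * (opNorm A * (Fintype.card ι * √δ)) := by
  set N : ℝ := (Fintype.card ι : ℝ) with hN
  have hN0 : 0 ≤ N := by positivity
  have hNpos : 0 < N := by
    rcases hN0.eq_or_lt with h | h
    · have : IsEmpty ι := Fintype.card_eq_zero_iff.mp (by exact_mod_cast hN ▸ h.symm)
      simp [Matrix.trace] at ht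
    · exact h
  have hS : (A * ((√N • CFC.sqrt ρ)ᵀ * (√N • CFC.sqrt ρ))).trace = N * (A * ρ).trace := by
    rw [Matrix.transpose_smul, Matrix.smul_mul, Matrix.mul_smul (CFC.sqrt ρ)ᵀ, smul_smul,
      Real.mul_self_sqrt hN0, transpose_sqrt_mul_sqrt hρ, Matrix.mul_smul, Matrix.trace_smul,
      smul_eq_mul]
  rw [← hS]
  have hbound : √N * √(N * δ) = N * √δ := by
    rw [Real.sqrt_mul hN0, ← mul_assoc, Real.mul_self_sqrt hN0]
  rw [← hbound]
  apply abs_trace_mul_gram_sub_le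
  · rw [Finset.sum_comm]
    calc ∑ i, ∑ k, unitCols ρ k i ^ 2 ≤ ∑ i : ι, (1 : ℝ) := by
          refine Finset.sum_le_sum fun i _ => ?_
          rw [sum_unitCols_sq hρ]; split_ifs <;> norm_num
      _ = N := by simp [hN]
  · rw [Finset.sum_comm]
    refine le_of_eq ?_
    calc ∑ i, ∑ k, (√N • CFC.sqrt ρ) k i ^ 2 = ∑ i, N * ρ i i := by
          refine Finset.sum_congr rfl fun i _ => ?_
          simp only [Matrix.smul_apply, smul_eq_mul, mul_pow, ← Finset.mul_sum, sum_sqrt_sq hρ,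
            Real.sq_sqrt hN0]
      _ = N * ρ.trace := by rw [← Finset.mul_sum]; rfl
      _ = N := by rw [ht, mul_one]
  · rw [Finset.sum_comm]
    calc ∑ i, ∑ k, (unitCols ρ - √N • CFC.sqrt ρ) k i ^ 2
        ≤ ∑ i, N * |ρ i i - 1 / N| := by
          refine Finset.sum_le_sum fun i _ => ?_
          have e : ∀ k, (unitCols ρ - √N • CFC.sqrt ρ) k i ^ 2 =
              ((√(ρ i i))⁻¹ - √N) ^ 2 * CFC.sqrt ρ k i ^ 2 := fun k => by
            simp only [unitCols, Matrix.sub_apply, Matrix.of_apply, Matrix.smul_apply, smul_eq_mul]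
            ring
          simp only [e, ← Finset.mul_sum, sum_sqrt_sq hρ]
          have hr : 0 ≤ ρ i i := hρ.diag_nonneg
          rcases hr.eq_or_lt with h0 | h0
          · rw [← h0]; simp; positivity
          · have hs := Real.sqrt_pos.mpr h0
            have hsn := Real.sqrt_pos.mpr hNpos
            -- With `s = √(N ρ i i)`, the claim is `(1 - s)² ≤ |1 - s²|`, which follows from `|1 -
            -- s| ≤ 1 + s`.
            have e1 : ((√(ρ i i))⁻¹ - √N) ^ 2 * ρ i i = (1 - √N * √(ρ i i)) ^ 2 := by
              conv_lhs => rw [← Real.sq_sqrt hr]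
              rw [Real.sqrt_sq hs.le]
              field_simp
            have e2 : N * |ρ i i - 1 / N| = |1 - √N * √(ρ i i)| * (1 + √N * √(ρ i i)) := by
              rw [← abs_of_pos (show 0 < 1 + √N * √(ρ i i) by positivity), ← abs_mul]
              conv_lhs => rw [← abs_of_pos hNpos, ← abs_mul, abs_of_pos hNpos]
              have a := Real.sq_sqrt hr
              have b := Real.sq_sqrt hN0
              have e3 : N * (ρ i i - 1 / N) = -((1 - √N * √(ρ i i)) * (1 + √N * √(ρ i i))) := by
                rw [mul_sub, mul_one_div_cancel hNpos.ne']
                linear_combination -N * a - √(ρ i i) ^ 2 * b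
              rw [e3, abs_neg]
            rw [e1, e2, ← sq_abs, sq]
            gcongr
            rw [abs_le]
            constructor <;> nlinarith [mul_pos hsn hs]
      _ ≤ N * δ := by
          rw [← Finset.mul_sum]
          gcongr

end Sqrt

end LinearAlgebra

/-! ### The block matrix and the two-sided consequence of optimality. -/

section Lift

variable {n : ℕ} (A : Matrix (Fin n) (Fin n) ℝ)

lemma dotProduct_lift_mulVec (u v : Fin n ⊕ Fin n → ℝ) :
    u ⬝ᵥ lift A *ᵥ v = (u ∘ Sum.inl) ⬝ᵥ A *ᵥ (v ∘ Sum.inr) + (v ∘ Sum.inl) ⬝ᵥ A *ᵥ (u ∘ Sum.inr) := by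
  rw [lift, Matrix.fromBlocks_mulVec]
  simp only [dotProduct, Fintype.sum_sum_type, Sum.elim_inl, Sum.elim_inr, zero_mulVec, zero_add,
    add_zero, Function.comp_apply]
  congr 1
  have h := Matrix.dotProduct_mulVec (v ∘ Sum.inl) A (u ∘ Sum.inr)
  rw [← Matrix.mulVec_transpose, dotProduct_comm (Aᵀ *ᵥ _)] at h
  exact h.symm

lemma opNorm_lift_le : opNorm (lift A) ≤ opNorm A := by
  refine opNorm_le_of_abs_dotProduct_le (opNorm_nonneg A) fun u v => ?_
  rw [dotProduct_lift_mulVec]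
  have h1 := abs_dotProduct_mulVec_le A (u ∘ Sum.inl) (v ∘ Sum.inr)
  have h2 := abs_dotProduct_mulVec_le A (v ∘ Sum.inl) (u ∘ Sum.inr)
  refine (abs_add_le _ _).trans ((add_le_add h1 h2).trans ?_)
  rw [← mul_add]
  refine mul_le_mul_of_nonneg_left ?_ (opNorm_nonneg A)
  simp only [Fintype.sum_sum_type, Function.comp_apply]
  have n1 : 0 ≤ ∑ i, u (Sum.inl i) ^ 2 := Finset.sum_nonneg fun i _ => sq_nonneg _
  have n2 : 0 ≤ ∑ i, u (Sum.inr i) ^ 2 := Finset.sum_nonneg fun i _ => sq_nonneg _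
  have n3 : 0 ≤ ∑ i, v (Sum.inl i) ^ 2 := Finset.sum_nonneg fun i _ => sq_nonneg _
  have n4 : 0 ≤ ∑ i, v (Sum.inr i) ^ 2 := Finset.sum_nonneg fun i _ => sq_nonneg _
  rw [← Real.sqrt_mul (add_nonneg n1 n2)]
  apply Real.le_sqrt_of_sq_le
  have q1 := Real.sq_sqrt n1
  have q2 := Real.sq_sqrt n2
  have q3 := Real.sq_sqrt n3
  have q4 := Real.sq_sqrt n4
  rw [← q1, ← q2, ← q3, ← q4]
  simp only [Real.sqrt_sq (Real.sqrt_nonneg _)]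
  -- Cauchy–Schwarz in the plane for the block norms; the square given is the exact defect in
  -- Lagrange's identity.
  nlinarith [sq_nonneg (√(∑ i, u (Sum.inl i) ^ 2) * √(∑ i, v (Sum.inl i) ^ 2) -
    √(∑ i, u (Sum.inr i) ^ 2) * √(∑ i, v (Sum.inr i) ^ 2))]

lemma trace_lift_mul (X : Matrix (Fin n ⊕ Fin n) (Fin n ⊕ Fin n) ℝ) :
    (lift A * X).trace =
      ∑ i, ∑ j, A i j * (X (Sum.inr j) (Sum.inl i) + X (Sum.inl i) (Sum.inr j)) := by
  simp only [Matrix.trace, Matrix.diag_apply, Matrix.mul_apply, lift, Fintype.sum_sum_type,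
    Matrix.fromBlocks_apply₁₁, Matrix.fromBlocks_apply₁₂, Matrix.fromBlocks_apply₂₁,
    Matrix.fromBlocks_apply₂₂, Matrix.zero_apply, zero_mul, Finset.sum_const_zero, zero_add,
    add_zero, Matrix.transpose_apply, mul_add, Finset.sum_add_distrib]
  rw [add_comm]
  congr 1
  exact Finset.sum_comm

variable {A} {ρ : Matrix (Fin n ⊕ Fin n) (Fin n ⊕ Fin n) ℝ} {δ : ℝ}

/-- An approximately optimal point bounds the objective at every positive semidefinite matrix
with bounded diagonal. -/
lemma IsApproxOptimal.trace_le (hρ : IsApproxOptimal (lift A) δ ρ) (hn : 0 < n)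
    {Y : Matrix (Fin n ⊕ Fin n) (Fin n ⊕ Fin n) ℝ} (hY : Y.PosSemidef) {c : ℝ} (hc : 0 < c)
    (hd : ∀ i, Y i i ≤ c) :
    (lift A * Y).trace ≤
      c * (Fintype.card (Fin n ⊕ Fin n) * ((lift A * ρ).trace + δ * opNorm (lift A))) := by
  set N : ℝ := (Fintype.card (Fin n ⊕ Fin n) : ℝ) with hN
  have hNpos : 0 < N := by rw [hN]; simp; omega
  -- Raising the diagonal to the constant `c` keeps `Y` positive semidefinite, and is invisible to
  -- `lift A`, whose diagonal vanishes. Dividing by `c * N` makes the result feasible.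
  set X := (c * N)⁻¹ • (Y + diagonal fun i => c - Y i i) with hX
  have hXd : ∀ i, X i i = 1 / N := fun i => by
    simp only [hX, Matrix.smul_apply, Matrix.add_apply, Matrix.diagonal_apply_eq, smul_eq_mul]
    field_simp
    ring
  have hfeas : IsFeasible X := by
    refine ⟨?_, ?_, hXd⟩
    · refine Matrix.PosSemidef.smul (hY.add ?_) (by positivity)
      exact Matrix.PosSemidef.diagonal fun i => by simpa using hd i
    · simp only [Matrix.trace, Matrix.diag_apply, hXd]
      rw [Finset.sum_const, Finset.card_univ, nsmul_eq_mul, ← hN]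
      field_simp
  have htr : (lift A * Y).trace = c * N * (lift A * X).trace := by
    simp only [trace_lift_mul, hX, Matrix.smul_apply, Matrix.add_apply, smul_eq_mul,
      Finset.mul_sum]
    refine Finset.sum_congr rfl fun i _ => Finset.sum_congr rfl fun j _ => ?_
    rw [Matrix.diagonal_apply_ne _ (by simp), Matrix.diagonal_apply_ne _ (by simp)]
    field_simp
    ring
  rw [htr, mul_assoc]
  refine mul_le_mul_of_nonneg_left (mul_le_mul_of_nonneg_left ?_ hNpos.le) hc.le
  have h := hρ X hfeas
  simp only [value, Matrix.smul_mul, Matrix.trace_smul, smul_eq_mul] at h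
  -- If the norm is zero, `1 / 0 = 0` makes `h` carry no information, but then `lift A = 0` and both
  -- traces vanish.
  rcases (opNorm_nonneg (lift A)).eq_or_lt with h0 | h0
  · have hA0 : lift A = 0 := by
      have : ‖Matrix.toEuclideanCLM (𝕜 := ℝ) (lift A)‖ = 0 := h0.symm
      simpa using this
    simp [hA0, opNorm]
  · have := mul_le_mul_of_nonneg_left h h0.le
    field_simp at this
    linarith

/-- The lower counterpart of `IsApproxOptimal.trace_le`, by conjugation with `diag(1, -1)`. -/
lemma IsApproxOptimal.neg_le_trace (hρ : IsApproxOptimal (lift A) δ ρ) (hn : 0 < n)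
    {Y : Matrix (Fin n ⊕ Fin n) (Fin n ⊕ Fin n) ℝ} (hY : Y.PosSemidef) {c : ℝ} (hc : 0 < c)
    (hd : ∀ i, Y i i ≤ c) :
    -(c * (Fintype.card (Fin n ⊕ Fin n) * ((lift A * ρ).trace + δ * opNorm (lift A)))) ≤
      (lift A * Y).trace := by
  set d : Fin n ⊕ Fin n → ℝ := Sum.elim (fun _ => 1) (fun _ => -1) with hdd
  have hD : ∀ i j, (diagonal d * Y * diagonal d) i j = d i * Y i j * d j := fun i j => by
    simp [Matrix.mul_diagonal, Matrix.diagonal_mul]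
  have hP : (diagonal d * Y * diagonal d).PosSemidef := by
    simpa [Matrix.conjTranspose, Matrix.diagonal_transpose] using
      hY.mul_mul_conjTranspose_same (diagonal d)
  have h := hρ.trace_le hn hP hc (fun i => by rw [hD]; rcases i with i | i <;> simpa [hdd] using hd _)
  have e : (lift A * (diagonal d * Y * diagonal d)).trace = -(lift A * Y).trace := by
    simp only [trace_lift_mul, hD, ← Finset.sum_neg_distrib]
    refine Finset.sum_congr rfl fun i _ => Finset.sum_congr rfl fun j _ => ?_
    simp only [hdd, Sum.elim_inl, Sum.elim_inr]
    ring
  rw [e] at h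
  linarith

end Lift

/-! ### The sign function and the first absolute Gaussian moment. -/

section Sgn

lemma measurable_sgn : Measurable sgn :=
  Measurable.ite measurableSet_Ici measurable_const measurable_const

lemma sgn_mul_self (t : ℝ) : sgn t * t = |t| := by
  unfold sgn
  split_ifs with h
  · rw [one_mul, abs_of_nonneg h]
  · rw [abs_of_neg (not_le.mp h)]; ring

lemma sgn_sq (t : ℝ) : sgn t ^ 2 = 1 := by
  unfold sgn
  split_ifs <;> norm_num

lemma sgn_mul_of_pos {c : ℝ} (hc : 0 < c) (t : ℝ) : sgn (c * t) = sgn t := by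
  unfold sgn
  simp [mul_nonneg_iff_of_pos_left hc]

end Sgn

lemma integral_abs_gaussianReal : ∫ x, |x| ∂gaussianReal 0 1 = √(2 / Real.pi) := by
  rw [integral_gaussianReal_eq_integral_smul one_ne_zero]
  have h := integral_rpow_mul_exp_neg_mul_rpow (p := 2) (q := 1) (b := 1 / 2)
    (by norm_num) (by norm_num) (by norm_num)
  have h1 : ∫ x in Set.Ioi (0 : ℝ), x * Real.exp (-(1 / 2) * x ^ 2) = 1 := by
    -- The Gamma integral evaluated at `Γ(1) = 1`.
    have e : ((1 : ℝ) / 2) ^ (-(1 + 1) / 2 : ℝ) * (1 / 2) * Real.Gamma ((1 + 1) / 2) = 1 := by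
      norm_num [Real.rpow_neg_one]
    rw [e] at h
    simpa using h
  have h2 : (fun x : ℝ => gaussianPDFReal 0 1 x • |x|) =
      fun x => (fun t => (√(2 * Real.pi))⁻¹ * (t * Real.exp (-(1 / 2) * t ^ 2))) |x| := by
    ext x
    simp only [gaussianPDFReal, sq_abs, smul_eq_mul, NNReal.coe_one, mul_one, sub_zero]
    rw [show -x ^ 2 / 2 = -(1 / 2) * x ^ 2 by ring]
    ring
  rw [h2, integral_comp_abs (f := fun t => (√(2 * Real.pi))⁻¹ * (t * Real.exp (-(1 / 2) * t ^ 2))),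
    integral_const_mul, h1, mul_one]
  rw [← Real.sqrt_inv, show (2 : ℝ) / Real.pi = 2 ^ 2 * (2 * Real.pi)⁻¹ by field_simp,
    Real.sqrt_mul (by norm_num), Real.sqrt_sq (by norm_num)]

/-! ### Second moment matrices. -/

section Moments

variable {Ω ι : Type*} [MeasurableSpace Ω] [Fintype ι] {P : Measure Ω} {r : ι → Ω → ℝ}

/-- The matrix of second moments of a random vector. -/
noncomputable def secondMoment (P : Measure Ω) (r : ι → Ω → ℝ) : Matrix ι ι ℝ :=
  Matrix.of fun i j => ∫ ω, r i ω * r j ω ∂P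

lemma integrable_mul_of_memLp_two {X Y : Ω → ℝ} (hX : MemLp X 2 P) (hY : MemLp Y 2 P) :
    Integrable (fun ω => X ω * Y ω) P := hX.integrable_mul hY

lemma integral_dotProduct_mulVec (hr : ∀ i, MemLp (r i) 2 P) (A : Matrix ι ι ℝ) :
    ∫ ω, (fun i => r i ω) ⬝ᵥ A *ᵥ (fun i => r i ω) ∂P = (A * secondMoment P r).trace := by
  have hi : ∀ i j, Integrable (fun ω => r i ω * (A i j * r j ω)) P := fun i j =>
    integrable_mul_of_memLp_two (hr i) ((hr j).const_mul _)
  simp only [dotProduct, Matrix.mulVec, Finset.mul_sum, Matrix.trace, Matrix.diag_apply,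
    Matrix.mul_apply, secondMoment, Matrix.of_apply]
  rw [integral_finsetSum _ fun i _ => integrable_finsetSum _ fun j _ => hi i j]
  refine Finset.sum_congr rfl fun i _ => ?_
  rw [integral_finsetSum _ fun j _ => hi i j]
  refine Finset.sum_congr rfl fun j _ => ?_
  rw [← integral_const_mul]
  congr 1 with ω
  ring

lemma posSemidef_secondMoment (hr : ∀ i, MemLp (r i) 2 P) : (secondMoment P r).PosSemidef := by
  classical
  refine Matrix.PosSemidef.of_dotProduct_mulVec_nonneg ?_ fun u => ?_
  · ext i j
    simp [secondMoment, Matrix.conjTranspose, mul_comm]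
  -- Testing against `u uᵀ` writes the quadratic form as `E[⟨u, r⟩²]`.
  · have h := integral_dotProduct_mulVec hr (vecMulVec u u)
    rw [Matrix.trace_mul_comm, trace_mul_vecMulVec_self] at h
    rw [star_trivial, ← h]
    refine integral_nonneg fun ω => ?_
    simp only [Pi.zero_apply, Matrix.vecMulVec_mulVec, dotProduct_smul, MulOpposite.smul_eq_mul_unop,
      MulOpposite.unop_op]
    rw [dotProduct_comm _ u]
    exact mul_self_nonneg _

end Moments

/-! ### Correlations of Gaussian projections and their signs. -/

section Gaussian

variable {Ω ι : Type*} [MeasurableSpace Ω] [Fintype ι] {P : Measure Ω}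
  {g : ι → Ω → ℝ}

lemma hasGaussianLaw_of_std (hg : ∀ i, HasLaw (g i) (gaussianReal 0 1) P) (hi : iIndepFun g P) :
    HasGaussianLaw (fun ω i => g i ω) P :=
  hi.hasGaussianLaw fun i => (hg i).hasGaussianLaw

lemma hasGaussianLaw_dotProduct_prod (hG : HasGaussianLaw (fun ω i => g i ω) P) (a b : ι → ℝ) :
    HasGaussianLaw (fun ω => (a ⬝ᵥ (fun k => g k ω), b ⬝ᵥ (fun k => g k ω))) P := by
  let L : (ι → ℝ) → (ι → ℝ) →L[ℝ] ℝ := fun a =>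
    LinearMap.toContinuousLinearMap (dotProductBilin ℝ ℝ a)
  exact hG.map_fun ((L a).prod (L b))

lemma hasGaussianLaw_dotProduct (hG : HasGaussianLaw (fun ω i => g i ω) P) (a : ι → ℝ) :
    HasGaussianLaw (fun ω => a ⬝ᵥ (fun k => g k ω)) P :=
  (hasGaussianLaw_dotProduct_prod hG a a).fst

lemma memLp_dotProduct (hG : HasGaussianLaw (fun ω i => g i ω) P) (a : ι → ℝ) :
    MemLp (fun ω => a ⬝ᵥ (fun k => g k ω)) 2 P :=
  (hasGaussianLaw_dotProduct hG a).memLp_two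

lemma integral_dotProduct (hg : ∀ i, HasLaw (g i) (gaussianReal 0 1) P) (a : ι → ℝ) :
    ∫ ω, a ⬝ᵥ (fun k => g k ω) ∂P = 0 := by
  simp only [dotProduct]
  rw [integral_finsetSum _ fun i _ => ((hg i).hasGaussianLaw.integrable).const_mul _]
  refine Finset.sum_eq_zero fun i _ => ?_
  rw [integral_const_mul, (hg i).integral_eq, integral_id_gaussianReal, mul_zero]

lemma integral_mul_of_std {ι : Type*} [DecidableEq ι] {g : ι → Ω → ℝ}
    (hg : ∀ i, HasLaw (g i) (gaussianReal 0 1) P)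
    (hi : iIndepFun g P) (i j : ι) : ∫ ω, g i ω * g j ω ∂P = if i = j then 1 else 0 := by
  have h0 : ∀ i, ∫ ω, g i ω ∂P = 0 := fun i => by
    rw [(hg i).integral_eq, integral_id_gaussianReal]
  split_ifs with h
  · subst h
    have hv := (hg i).variance_eq
    rw [variance_of_integral_eq_zero (hg i).aemeasurable (h0 i), variance_id_gaussianReal] at hv
    simpa [sq] using hv
  · rw [(hi.indepFun h).integral_fun_mul_eq_mul_integral
      (hg i).aemeasurable.aestronglyMeasurable (hg j).aemeasurable.aestronglyMeasurable, h0,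
      zero_mul]

lemma integral_dotProduct_mul_dotProduct (hg : ∀ i, HasLaw (g i) (gaussianReal 0 1) P)
    (hi : iIndepFun g P) (a b : ι → ℝ) :
    ∫ ω, (a ⬝ᵥ fun k => g k ω) * (b ⬝ᵥ fun k => g k ω) ∂P = a ⬝ᵥ b := by
  classical
  have hm : ∀ i, MemLp (g i) 2 P := fun i => (hg i).hasGaussianLaw.memLp_two
  have hI : ∀ i j, Integrable (fun ω => a i * g i ω * (b j * g j ω)) P := fun i j =>
    integrable_mul_of_memLp_two ((hm i).const_mul _) ((hm j).const_mul _)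
  simp only [dotProduct, Finset.sum_mul_sum]
  rw [integral_finsetSum _ fun i _ => integrable_finsetSum _ fun j _ => hI i j]
  refine Finset.sum_congr rfl fun i _ => ?_
  rw [integral_finsetSum _ fun j _ => hI i j]
  have : ∀ j, ∫ ω, a i * g i ω * (b j * g j ω) ∂P = a i * b j * if i = j then 1 else 0 := by
    intro j
    rw [← integral_mul_of_std hg hi, ← integral_const_mul]
    congr 1 with ω
    ring
  simp [this]

/-- Correlation between the sign of a standard normal projection and another projection. -/
lemma integral_sgn_dotProduct_mul_dotProduct (hg : ∀ i, HasLaw (g i) (gaussianReal 0 1) P)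
    (hi : iIndepFun g P) {a : ι → ℝ} (ha : a ⬝ᵥ a = 1) (b : ι → ℝ) :
    ∫ ω, sgn (a ⬝ᵥ fun k => g k ω) * (b ⬝ᵥ fun k => g k ω) ∂P = √(2 / Real.pi) * (a ⬝ᵥ b) := by
  have := hi.isProbabilityMeasure
  have hG := hasGaussianLaw_of_std hg hi
  set X : (ι → ℝ) → Ω → ℝ := fun a ω => a ⬝ᵥ fun k => g k ω with hX
  -- The part of `b` orthogonal to `a`: its projection is uncorrelated with that of `a`, hence
  -- independent by joint Gaussianity, and contributes nothing. The part along `a` gives `(a ⬝ᵥ b)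
  -- E|Z|` with `Z` standard normal.
  set c : ι → ℝ := b - (a ⬝ᵥ b) • a with hc
  have hac : a ⬝ᵥ c = 0 := by
    rw [hc, dotProduct_sub, dotProduct_smul, ha, smul_eq_mul, mul_one, sub_self]
  have hcov : cov[X a, X c; P] = 0 := by
    rw [covariance_eq_sub (memLp_dotProduct hG a) (memLp_dotProduct hG c)]
    have h1 : ∫ ω, (X a * X c) ω ∂P = a ⬝ᵥ c := integral_dotProduct_mul_dotProduct hg hi a c
    rw [h1, integral_dotProduct hg a, hac]
    ring
  have hind : IndepFun (X a) (X c) P :=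
    (hasGaussianLaw_dotProduct_prod hG a c).indepFun_of_covariance_eq_zero hcov
  have hma := (hasGaussianLaw_dotProduct hG a).aemeasurable
  have hmc := (hasGaussianLaw_dotProduct hG c).aemeasurable
  have hzero : ∫ ω, sgn (X a ω) * X c ω ∂P = 0 := by
    have h := (hind.comp measurable_sgn measurable_id).integral_fun_mul_eq_mul_integral
      (measurable_sgn.comp_aemeasurable hma).aestronglyMeasurable hmc.aestronglyMeasurable
    simp only [Function.comp_apply, id] at h
    rw [h, integral_dotProduct hg c, mul_zero]
  have habs : ∫ ω, sgn (X a ω) * X a ω ∂P = √(2 / Real.pi) := by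
    simp only [sgn_mul_self]
    have hlaw := (hasGaussianLaw_dotProduct hG a).map_eq_gaussianReal
    rw [integral_dotProduct hg a, variance_of_integral_eq_zero hma (integral_dotProduct hg a)] at hlaw
    have hv : ∫ ω, (a ⬝ᵥ fun k => g k ω) ^ 2 ∂P = 1 := by
      simp only [sq]
      rw [integral_dotProduct_mul_dotProduct hg hi, ha]
    rw [hv, Real.toNNReal_one] at hlaw
    rw [← integral_abs_gaussianReal, ← hlaw, integral_map hma (by fun_prop)]
  have hbdd : ∀ d : ι → ℝ, Integrable (fun ω => sgn (X a ω) * X d ω) P := fun d => by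
    refine (memLp_dotProduct hG d).integrable (by norm_num) |>.bdd_mul (c := 1)
      (measurable_sgn.comp_aemeasurable hma).aestronglyMeasurable (ae_of_all _ fun ω => ?_)
    rw [Real.norm_eq_abs, ← sq_le_one_iff_abs_le_one, sgn_sq]
  have hb : ∀ ω, sgn (X a ω) * X b ω =
      (a ⬝ᵥ b) * (sgn (X a ω) * X a ω) + sgn (X a ω) * X c ω := fun ω => by
    have : X c ω = X b ω - (a ⬝ᵥ b) * X a ω := by
      simp only [hX, hc, sub_dotProduct, smul_dotProduct, smul_eq_mul]
    rw [this]
    ring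
  change ∫ ω, sgn (X a ω) * X b ω ∂P = _
  simp only [hb]
  rw [integral_add ((hbdd a).const_mul _) (hbdd c), integral_const_mul, habs, hzero]
  ring

end Gaussian

/-! ### The rounded vector, its truncation and its regression residual. -/

section Rounding

variable {Ω ι : Type*} [MeasurableSpace Ω] [Fintype ι] [DecidableEq ι] {P : Measure Ω}
  {g : ι → Ω → ℝ} {ρ : Matrix ι ι ℝ}

lemma roundVec_sq (ρ : Matrix ι ι ℝ) (u : ι → ℝ) (i : ι) : roundVec ρ u i ^ 2 = 1 := sgn_sq _

lemma col_unitCols_dotProduct (i : ι) (u : ι → ℝ) :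
    (unitCols ρ).col i ⬝ᵥ u = (√(ρ i i))⁻¹ * ((CFC.sqrt ρ).col i ⬝ᵥ u) := by
  simp only [dotProduct, Matrix.col_apply, unitCols, Matrix.of_apply, Finset.mul_sum, mul_assoc]

lemma roundVec_eq_sgn_unitCols (hρ : ρ.PosSemidef) {i : ι} (hi : ρ i i ≠ 0) (u : ι → ℝ) :
    roundVec ρ u i = sgn ((unitCols ρ).col i ⬝ᵥ u) := by
  rw [col_unitCols_dotProduct, sgn_mul_of_pos, roundVec]
  exact inv_pos.mpr (Real.sqrt_pos.mpr (hρ.diag_nonneg.lt_of_ne' hi))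

lemma col_unitCols_dotProduct_col (i j : ι) :
    (unitCols ρ).col i ⬝ᵥ (unitCols ρ).col j = ((unitCols ρ)ᵀ * unitCols ρ) i j := by
  simp [dotProduct, Matrix.mul_apply]

lemma col_unitCols_of_eq_zero {i : ι} (hi : ρ i i = 0) : (unitCols ρ).col i = 0 := by
  ext k
  simp [unitCols, hi]

lemma col_unitCols_dotProduct_self (hρ : ρ.PosSemidef) (i : ι) :
    (unitCols ρ).col i ⬝ᵥ (unitCols ρ).col i = if ρ i i = 0 then 0 else 1 := by
  rw [← sum_unitCols_sq hρ]
  simp [dotProduct, sq]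

/-- The rounded vector with the coordinates of the zero columns set to zero. -/
noncomputable def truncRoundVec (ρ : Matrix ι ι ℝ) (u : ι → ℝ) (i : ι) : ℝ :=
  if ρ i i = 0 then 0 else roundVec ρ u i

lemma truncRoundVec_sq (ρ : Matrix ι ι ℝ) (u : ι → ℝ) (i : ι) :
    truncRoundVec ρ u i ^ 2 = if ρ i i = 0 then 0 else 1 := by
  unfold truncRoundVec
  split_ifs
  · norm_num
  · exact roundVec_sq ρ u i

lemma measurable_roundVec (i : ι) : Measurable fun u => roundVec ρ u i := by
  have : Measurable fun u : ι → ℝ => (CFC.sqrt ρ).col i ⬝ᵥ u := by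
    unfold dotProduct
    fun_prop
  exact measurable_sgn.comp this

lemma measurable_truncRoundVec (i : ι) : Measurable fun u => truncRoundVec ρ u i := by
  unfold truncRoundVec
  split_ifs
  · exact measurable_const
  · exact measurable_roundVec i

lemma memLp_roundVec [IsProbabilityMeasure P] (hg : AEMeasurable (fun ω k => g k ω) P) (i : ι) :
    MemLp (fun ω => roundVec ρ (fun k => g k ω) i) 2 P := by
  refine MemLp.of_bound ((measurable_roundVec i).comp_aemeasurable hg).aestronglyMeasurable 1
    (ae_of_all _ fun ω => ?_)
  rw [Real.norm_eq_abs, ← sq_le_one_iff_abs_le_one, roundVec_sq]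

lemma memLp_truncRoundVec [IsProbabilityMeasure P] (hg : AEMeasurable (fun ω k => g k ω) P)
    (i : ι) : MemLp (fun ω => truncRoundVec ρ (fun k => g k ω) i) 2 P := by
  refine MemLp.of_bound ((measurable_truncRoundVec i).comp_aemeasurable hg).aestronglyMeasurable 1
    (ae_of_all _ fun ω => ?_)
  rw [Real.norm_eq_abs, ← sq_le_one_iff_abs_le_one, truncRoundVec_sq]
  split_ifs <;> norm_num

/-- Truncation is needed because `sgn 0 = 1`: a zero column would give a residual of variance `1`,
exceeding `1 - 2/π`. Each such index costs `1 / card ι` in the diagonal deviation, so there are at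
most `card ι * δ` of them. -/
lemma sum_roundVec_sub_truncRoundVec_sq_le {δ : ℝ} [Nonempty ι]
    (hδ : ∑ i, |ρ i i - 1 / (Fintype.card ι : ℝ)| ≤ δ) (u : ι → ℝ) :
    ∑ i, (roundVec ρ u i - truncRoundVec ρ u i) ^ 2 ≤ Fintype.card ι * δ := by
  have hN : (0 : ℝ) < Fintype.card ι := by exact_mod_cast Fintype.card_pos
  refine le_trans ?_ (mul_le_mul_of_nonneg_left hδ hN.le)
  rw [Finset.mul_sum]
  refine Finset.sum_le_sum fun i _ => ?_
  unfold truncRoundVec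
  split_ifs with h
  · rw [h, sub_zero, roundVec_sq, zero_sub, abs_neg, abs_of_pos (by positivity),
      mul_one_div_cancel hN.ne']
  · rw [sub_self, zero_pow two_ne_zero]; positivity

/-- Truncating the rounded vector changes its second moments only slightly when tested
against `A`. -/
lemma abs_trace_secondMoment_sub_le [IsProbabilityMeasure P] [Nonempty ι]
    (hg : AEMeasurable (fun ω k => g k ω) P) {δ : ℝ}
    (hδ : ∑ i, |ρ i i - 1 / (Fintype.card ι : ℝ)| ≤ δ) (A : Matrix ι ι ℝ) :
    |(A * secondMoment P fun i ω => roundVec ρ (fun k => g k ω) i).trace -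
        (A * secondMoment P fun i ω => truncRoundVec ρ (fun k => g k ω) i).trace| ≤
      2 * (opNorm A * (Fintype.card ι * √δ)) := by
  have hx := memLp_roundVec (ρ := ρ) hg
  have hx' := memLp_truncRoundVec (ρ := ρ) hg
  have hI : ∀ r : ι → Ω → ℝ, (∀ i, MemLp (r i) 2 P) →
      Integrable (fun ω => (fun i => r i ω) ⬝ᵥ A *ᵥ (fun i => r i ω)) P := fun r hr => by
    simp only [dotProduct, Matrix.mulVec, Finset.mul_sum]
    exact integrable_finsetSum _ fun i _ => integrable_finsetSum _ fun j _ =>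
      integrable_mul_of_memLp_two (hr i) ((hr j).const_mul _)
  rw [← integral_dotProduct_mulVec hx, ← integral_dotProduct_mulVec hx',
    ← integral_sub (hI _ hx) (hI _ hx'), ← Real.norm_eq_abs]
  -- The two quadratic forms are close for every `ω`, not only on average.
  refine (norm_integral_le_of_norm_le_const (ae_of_all _ fun ω => ?_)).trans_eq
    (by rw [probReal_univ, mul_one])
  have h := abs_dotProduct_mulVec_sub_le A (fun i => roundVec ρ (fun k => g k ω) i)
    (fun i => truncRoundVec ρ (fun k => g k ω) i) (s := Fintype.card ι)
    (t := Fintype.card ι * δ) (by simp [roundVec_sq])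
    (by
      simp only [truncRoundVec_sq]
      calc ∑ i, (if ρ i i = 0 then (0 : ℝ) else 1) ≤ ∑ i : ι, (1 : ℝ) :=
            Finset.sum_le_sum fun i _ => by split_ifs <;> norm_num
        _ = _ := by simp)
    (sum_roundVec_sub_truncRoundVec_sq_le hδ _)
  rwa [Real.sqrt_mul (Nat.cast_nonneg _), ← mul_assoc √_, Real.mul_self_sqrt (Nat.cast_nonneg _)]
    at h

/-- The part of the truncated rounded vector not explained by its linear regression. -/
noncomputable def residual (ρ : Matrix ι ι ℝ) (u : ι → ℝ) (i : ι) : ℝ :=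
  truncRoundVec ρ u i - √(2 / Real.pi) * ((unitCols ρ).col i ⬝ᵥ u)

lemma integral_truncRoundVec_mul (hρ : ρ.PosSemidef)
    (hg : ∀ i, HasLaw (g i) (gaussianReal 0 1) P) (hi : iIndepFun g P) (i : ι) (b : ι → ℝ) :
    ∫ ω, truncRoundVec ρ (fun k => g k ω) i * (b ⬝ᵥ fun k => g k ω) ∂P =
      √(2 / Real.pi) * ((unitCols ρ).col i ⬝ᵥ b) := by
  by_cases h : ρ i i = 0
  · simp [truncRoundVec, h, col_unitCols_of_eq_zero h]
  · simp only [truncRoundVec, h, if_false, roundVec_eq_sgn_unitCols hρ h]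
    refine integral_sgn_dotProduct_mul_dotProduct hg hi ?_ b
    rw [col_unitCols_dotProduct_self hρ, if_neg h]

lemma memLp_residual (hg : ∀ i, HasLaw (g i) (gaussianReal 0 1) P) (hi : iIndepFun g P) (i : ι) :
    MemLp (fun ω => residual ρ (fun k => g k ω) i) 2 P := by
  have := hi.isProbabilityMeasure
  have hG := hasGaussianLaw_of_std hg hi
  exact (memLp_truncRoundVec hG.aemeasurable i).sub ((memLp_dotProduct hG _).const_mul _)

/-- Each of the two cross terms and the Gaussian term has size `(2/π) UᵀU`, with signs `-`, `-`,
`+`; one copy is left, subtracted. -/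
lemma secondMoment_residual (hρ : ρ.PosSemidef)
    (hg : ∀ i, HasLaw (g i) (gaussianReal 0 1) P) (hi : iIndepFun g P) :
    secondMoment P (fun i ω => residual ρ (fun k => g k ω) i) =
      secondMoment P (fun i ω => truncRoundVec ρ (fun k => g k ω) i) -
        (2 / Real.pi) • ((unitCols ρ)ᵀ * unitCols ρ) := by
  have := hi.isProbabilityMeasure
  have hG := hasGaussianLaw_of_std hg hi
  have ht := memLp_truncRoundVec (ρ := ρ) hG.aemeasurable
  have hl := fun i => memLp_dotProduct hG ((unitCols ρ).col i)
  ext i j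
  simp only [secondMoment, Matrix.of_apply, Matrix.sub_apply, Matrix.smul_apply, smul_eq_mul,
    ← col_unitCols_dotProduct_col]
  set c := √(2 / Real.pi) with hc
  have hcc : c * c = 2 / Real.pi := Real.mul_self_sqrt (by positivity)
  set t : ι → Ω → ℝ := fun i ω => truncRoundVec ρ (fun k => g k ω) i with htd
  set l : ι → Ω → ℝ := fun i ω => (unitCols ρ).col i ⬝ᵥ fun k => g k ω with hld
  have e : ∀ ω, residual ρ (fun k => g k ω) i * residual ρ (fun k => g k ω) j =
      (t i ω * t j ω - c * (t i ω * l j ω)) - (c * (t j ω * l i ω) - c * c * (l i ω * l j ω)) :=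
    fun ω => by simp only [residual, htd, hld, hc]; ring
  have i1 : Integrable (fun ω => t i ω * t j ω) P := integrable_mul_of_memLp_two (ht i) (ht j)
  have i2 : Integrable (fun ω => c * (t i ω * l j ω)) P :=
    (integrable_mul_of_memLp_two (ht i) (hl j)).const_mul _
  have i3 : Integrable (fun ω => c * (t j ω * l i ω)) P :=
    (integrable_mul_of_memLp_two (ht j) (hl i)).const_mul _
  have i4 : Integrable (fun ω => c * c * (l i ω * l j ω)) P :=
    (integrable_mul_of_memLp_two (hl i) (hl j)).const_mul _
  have i12 : Integrable (fun ω => t i ω * t j ω - c * (t i ω * l j ω)) P := i1.sub i2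
  have i34 : Integrable (fun ω => c * (t j ω * l i ω) - c * c * (l i ω * l j ω)) P := i3.sub i4
  simp only [e]
  rw [integral_sub i12 i34, integral_sub i1 i2, integral_sub i3 i4,
    integral_const_mul, integral_const_mul, integral_const_mul,
    integral_truncRoundVec_mul hρ hg hi, integral_truncRoundVec_mul hρ hg hi,
    integral_dotProduct_mul_dotProduct hg hi, dotProduct_comm ((unitCols ρ).col j), ← hc, ← hcc]
  ring

lemma secondMoment_residual_diag_le (hρ : ρ.PosSemidef)
    (hg : ∀ i, HasLaw (g i) (gaussianReal 0 1) P) (hi : iIndepFun g P) (i : ι) :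
    secondMoment P (fun i ω => residual ρ (fun k => g k ω) i) i i ≤ 1 - 2 / Real.pi := by
  have := hi.isProbabilityMeasure
  have hpi : 0 ≤ 1 - 2 / Real.pi := by
    rw [sub_nonneg, div_le_one Real.pi_pos]; exact Real.two_le_pi
  rw [secondMoment_residual hρ hg hi]
  simp only [Matrix.sub_apply, Matrix.smul_apply, smul_eq_mul, ← col_unitCols_dotProduct_col,
    col_unitCols_dotProduct_self hρ, secondMoment, Matrix.of_apply, ← sq, truncRoundVec_sq]
  split_ifs
  · simpa using hpi
  · simp

end Rounding

/-! ### Upper, lower and crude bounds for the rounded objective. -/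

section Bounds

variable {Ω : Type*} [MeasurableSpace Ω] {P : Measure Ω} {n : ℕ} {A : Matrix (Fin n) (Fin n) ℝ}
  {g : Fin n ⊕ Fin n → Ω → ℝ} {ρ : Matrix (Fin n ⊕ Fin n) (Fin n ⊕ Fin n) ℝ} {δ : ℝ}

lemma trace_lift_mul_secondMoment (x : Fin n ⊕ Fin n → Ω → ℝ) :
    (lift A * secondMoment P x).trace =
      2 * ∑ i, ∑ j, A i j * ∫ ω, x (Sum.inl i) ω * x (Sum.inr j) ω ∂P := by
  rw [trace_lift_mul, Finset.mul_sum]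
  refine Finset.sum_congr rfl fun i _ => ?_
  rw [Finset.mul_sum]
  refine Finset.sum_congr rfl fun j _ => ?_
  simp only [secondMoment, Matrix.of_apply, mul_comm (x (Sum.inr j) _)]
  ring

lemma trace_roundVec_le (hn : 0 < n) (ho : IsApproxOptimal (lift A) δ ρ)
    (hg : ∀ i, HasLaw (g i) (gaussianReal 0 1) P) (hi : iIndepFun g P) :
    (lift A * secondMoment P fun i ω => roundVec ρ (fun k => g k ω) i).trace ≤
      2 * n * ((lift A * ρ).trace + δ * opNorm (lift A)) := by
  have := hi.isProbabilityMeasure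
  have hG := hasGaussianLaw_of_std hg hi
  have h := ho.trace_le hn (posSemidef_secondMoment (memLp_roundVec (ρ := ρ) hG.aemeasurable))
    one_pos fun i => by
      simp [secondMoment, ← sq, roundVec_sq]
  rw [one_mul, Fintype.card_sum, Fintype.card_fin] at h
  push_cast at h
  linarith

lemma le_trace_roundVec (hn : 0 < n) (hf : IsApproxFeasible δ ρ)
    (ho : IsApproxOptimal (lift A) δ ρ)
    (hg : ∀ i, HasLaw (g i) (gaussianReal 0 1) P) (hi : iIndepFun g P) :
    2 * n * ((4 / Real.pi - 1) * (lift A * ρ).trace - δ * opNorm (lift A)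
        - 4 * (opNorm (lift A) * √δ)) ≤
      (lift A * secondMoment P fun i ω => roundVec ρ (fun k => g k ω) i).trace := by
  have := hi.isProbabilityMeasure
  have : Nonempty (Fin n ⊕ Fin n) := ⟨Sum.inl ⟨0, hn⟩⟩
  have hG := hasGaussianLaw_of_std hg hi
  have hpi : 0 < 1 - 2 / Real.pi := by
    rw [sub_pos, div_lt_one Real.pi_pos]; linarith [Real.pi_gt_three]
  have hpi' : 0 < 2 / Real.pi := by positivity
  have h1 := ho.neg_le_trace hn (posSemidef_secondMoment (memLp_residual (ρ := ρ) hg hi)) hpi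
    (secondMoment_residual_diag_le hf.posSemidef hg hi)
  rw [secondMoment_residual hf.posSemidef hg hi, Matrix.mul_sub, Matrix.trace_sub, Matrix.mul_smul,
    Matrix.trace_smul, smul_eq_mul] at h1
  have h2 := neg_le_of_abs_le
    (abs_trace_secondMoment_sub_le hG.aemeasurable hf.sum_diag_le (lift A))
  have h3 := neg_le_of_abs_le
    (abs_trace_unitCols_sub_le hf.posSemidef hf.trace_eq_one hf.sum_diag_le (lift A))
  have hN : (Fintype.card (Fin n ⊕ Fin n) : ℝ) = 2 * n := by simp; ring
  rw [hN] at h1 h2 h3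
  have hδ : 0 ≤ δ := le_trans (Finset.sum_nonneg fun _ _ => abs_nonneg _) hf.sum_diag_le
  have h3' := mul_le_mul_of_nonneg_left h3 hpi'.le
  have ha := opNorm_nonneg (lift A)
  -- The error `4 √δ` is `2 √δ` from truncation and `(2/π) * 2 √δ` from normalization; `h5` rounds
  -- this `2/π` up to `1`, and `h6` rounds `(1 - 2/π) δ` up to `δ`.
  have h5 : 0 ≤ (1 - 2 / Real.pi) * (2 * n * (opNorm (lift A) * √δ)) :=
    mul_nonneg hpi.le (by positivity)
  have h6 : 0 ≤ 2 / Real.pi * (2 * n * (δ * opNorm (lift A))) := by positivity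
  have e : (4 : ℝ) / Real.pi = 2 * (2 / Real.pi) := by ring
  rw [e]
  linarith

/-- A bound free of optimality, for the range `ε ≥ 1`, where `ε ^ 4` errors exceed the allowed order
`ε`. -/
lemma abs_trace_roundVec_le (hg : ∀ i, HasLaw (g i) (gaussianReal 0 1) P) (hi : iIndepFun g P) :
    |(lift A * secondMoment P fun i ω => roundVec ρ (fun k => g k ω) i).trace| ≤
      2 * n * opNorm (lift A) := by
  have := hi.isProbabilityMeasure
  have hG := hasGaussianLaw_of_std hg hi
  have h := abs_trace_mul_le (posSemidef_secondMoment (memLp_roundVec (ρ := ρ) hG.aemeasurable))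
    (lift A)
  refine h.trans_eq ?_
  simp [Matrix.trace, secondMoment, ← sq, roundVec_sq]
  ring

end Bounds

end MaxQP

/-! ### The main theorem. -/

theorem mainTheorem4 :
    ∃ C : ℝ, 0 < C ∧
      ∀ (n : ℕ) (A : Matrix (Fin n) (Fin n) ℝ) (ε : ℝ), 0 < ε →
      ∀ ρ : Matrix (Fin n ⊕ Fin n) (Fin n ⊕ Fin n) ℝ,
        MaxQP.IsApproxFeasible (ε ^ 4) ρ →
        MaxQP.IsApproxOptimal (MaxQP.lift A) (ε ^ 4) ρ →
      ∀ {Ω : Type*} [MeasurableSpace Ω] (P : Measure Ω) [IsProbabilityMeasure P]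
        (g : Fin n ⊕ Fin n → Ω → ℝ),
        (∀ i, HasLaw (g i) (gaussianReal 0 1) P) → iIndepFun g P →
        let x : Fin n ⊕ Fin n → Ω → ℝ := fun i ω => MaxQP.roundVec ρ (fun k => g k ω) i
        let y : Fin n → Ω → ℝ := fun i => x (Sum.inl i)
        let z : Fin n → Ω → ℝ := fun j => x (Sum.inr j)
        (4 / Real.pi - 1) * (n * (ρ * MaxQP.lift A).trace) - C * (ε * n * MaxQP.opNorm A)
            ≤ ∑ i, ∑ j, A i j * ∫ ω, y i ω * z j ω ∂P ∧
          ∑ i, ∑ j, A i j * ∫ ω, y i ω * z j ω ∂P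
            ≤ n * (ρ * MaxQP.lift A).trace + C * (ε * n * MaxQP.opNorm A) := by
  -- `5 = 1 + 4`: the errors `δ` and `4 √δ` with `δ = ε ^ 4` are at most `ε` and `4 ε` when `ε ≤ 1`.
  refine ⟨5, by norm_num, ?_⟩
  intro n A ε hε ρ hf ho Ω _ P _ g hg hi x y z
  rcases Nat.eq_zero_or_pos n with rfl | hn
  · simp
  have hQ := MaxQP.trace_lift_mul_secondMoment (P := P) (A := A) x
  change _ = 2 * ∑ i, ∑ j, A i j * ∫ ω, y i ω * z j ω ∂P at hQ
  set Q := ∑ i, ∑ j, A i j * ∫ ω, y i ω * z j ω ∂P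
  have h1 : (MaxQP.lift A * MaxQP.secondMoment P x).trace ≤ _ :=
    MaxQP.trace_roundVec_le hn ho hg hi
  have h2 : _ ≤ (MaxQP.lift A * MaxQP.secondMoment P x).trace :=
    MaxQP.le_trace_roundVec hn hf ho hg hi
  have h3 : |(MaxQP.lift A * MaxQP.secondMoment P x).trace| ≤ _ :=
    MaxQP.abs_trace_roundVec_le hg hi
  have h4 := MaxQP.abs_trace_mul_le hf.posSemidef (MaxQP.lift A)
  rw [hf.trace_eq_one, mul_one] at h4
  have hle := MaxQP.opNorm_lift_le A
  have hb0 := MaxQP.opNorm_nonneg (MaxQP.lift A)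
  rw [hQ] at h1 h2 h3
  rw [Matrix.trace_mul_comm ρ]
  set T := (MaxQP.lift A * ρ).trace
  set b := MaxQP.opNorm (MaxQP.lift A)
  have hn0 : (0 : ℝ) < n := by exact_mod_cast hn
  have hsqrt : √(ε ^ 4) = ε ^ 2 := by
    rw [show ε ^ 4 = (ε ^ 2) ^ 2 by ring, Real.sqrt_sq (sq_nonneg _)]
  rw [hsqrt] at h2
  have hnb : 0 ≤ n * b := by positivity
  have hεle : ε * (n * b) ≤ ε * n * MaxQP.opNorm A := by
    rw [mul_assoc]; gcongr
  rcases le_total ε 1 with hε1 | hε1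
  · have e2 : ε ^ 2 * (n * b) ≤ ε * (n * b) :=
      mul_le_mul_of_nonneg_right (pow_le_of_le_one hε.le hε1 two_ne_zero) hnb
    have e4 : ε ^ 4 * (n * b) ≤ ε * (n * b) :=
      mul_le_mul_of_nonneg_right (pow_le_of_le_one hε.le hε1 four_ne_zero) hnb
    constructor <;> nlinarith
  -- For `ε ≥ 1` both the objective and `n * T` are at most `n * b` in absolute value, which the
  -- error term absorbs.
  · have e1 : n * b ≤ ε * (n * b) := le_mul_of_one_le_left hnb hε1
    have hT : |n * T| ≤ n * b := by
      rw [abs_mul, abs_of_pos hn0]; gcongr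
    have hpi1 : 0 ≤ 4 / Real.pi - 1 := by
      rw [sub_nonneg, one_le_div Real.pi_pos]; exact Real.pi_le_four
    have hpi2 : 4 / Real.pi - 1 ≤ 1 := by
      rw [sub_le_iff_le_add, div_le_iff₀ Real.pi_pos]; linarith [Real.two_le_pi]
    have hT' : (4 / Real.pi - 1) * (n * T) ≤ n * b :=
      (mul_le_mul_of_nonneg_left (abs_le.mp hT).2 hpi1).trans
        (mul_le_of_le_one_left hnb hpi2)
    rw [abs_le] at h3 hT
    constructor <;> linarith [h3.1, h3.2, hT.1, hT.2]
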